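/- Let $m\ge 1$ be an integer and $\lambda>0$. For an integer $k\ge1$ and $w\ge 0$ let $\Gamma(k,w)=\int_w^\infty t^{k-1}e^{-t}\,dt$ and let $g(m,w)=\Gamma(m+1,w)-(m+1)\Gamma(m,w)$. A single additive buyer has values $x=(x_1,\dots,x_m)\in\mathbb R_+^m$ for $m$ goods, drawn i.i.d. from the exponential distribution with parameter $\lambda$; write $F$ for their joint law. A (possibly randomized) mechanism is a pair of functions $a:\mathbb R_+^m\to[0,1]^m$ (allocation probabilities) and $p:\mathbb R_+^m\to\mathbb R_+$ (payment). It is truthful if $a(x)\cdot x-p(x)\ge a(x')\cdot x-p(x')$ for all $x,x'\in\mathbb R_+^m$, and individually rational if $a(x)\cdot x-p(x)\ge 0$ for all $x\in\mathbb R_+^m$. Its revenue is $\mathbb E_{x\sim F}[p(x)]$. Full bundling at price $q\ge0$ is the deterministic mechanism that sells all goods for a total payment of $q$ if $\sum_j x_j\ge q$, and otherwise sells nothing and charges nothing. **Theorem.** The function $g(m,\cdot)$ has a unique root $\gamma^*_m$ in $[0,\infty)$, and $\gamma^*_m>0$. The payment function of every truthful, individually rational mechanism is $F$-integrable, and full bundling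 at price $\gamma^*_m/\lambda$ is truthful, individually rational, and has the largest revenue among all truthful, individually rational mechanisms. Among all bundle prices $q\ge 0$, $\gamma^*_m/\lambda$ is the only one for which full bundling is optimal. Moreover, the revenue of full bundling at price $\gamma^*_m/\lambda$ equals the maximum of $$R(u;F)=\int_{\mathbb R_+^m}\bigl(\nabla u(x)\cdot x-u(x)\bigr)\,dF(x)$$ over all nonnegative convex functions $u$ on $\mathbb R_+^m$ with $0\le \partial u/\partial x_j\le 1$ almost everywhere for every $j$. -/

import Mathlib

open MeasureTheory ProbabilityTheory

noncomputable section

/-- The upper incomplete Gamma function `Γ(m, w) = ∫_w^∞ t^(m-1) e^(-t) dt`, for `m ≥ 1`. -/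
def upperGamma (m : ℕ) (w : ℝ) : ℝ :=
  ∫ t in Set.Ioi w, t ^ (m - 1) * Real.exp (-t)

/-- `g(m, w) = Γ(m+1, w) - (m+1) Γ(m, w)`. -/
def gFun (m : ℕ) (w : ℝ) : ℝ :=
  upperGamma (m + 1) w - ((m : ℝ) + 1) * upperGamma m w

/-- The space of valuation (and bid) vectors: the nonnegative orthant of `ℝ^m`. -/
def valuationSpace (m : ℕ) : Set (Fin m → ℝ) :=
  {x | ∀ j, 0 ≤ x j}

/-- The joint law of `m` independent exponential values with common parameter `l`. -/
def iidExp (m : ℕ) (l : ℝ) : Measure (Fin m → ℝ) :=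
  Measure.pi fun _ : Fin m => expMeasure l

/-- The data of a direct-revelation mechanism for `m` goods: at the bid vector `x`, good `j` is
sold with probability `alloc x j` and the buyer is charged `pay x` in total.  Only bids in
`valuationSpace m` matter. -/
structure Mechanism (m : ℕ) where
  alloc : (Fin m → ℝ) → Fin m → ℝ
  pay : (Fin m → ℝ) → ℝ

namespace Mechanism

variable {m : ℕ}

/-- Utility of an additive buyer with true values `x` who reports `x'`. -/
def utility (M : Mechanism m) (x' x : Fin m → ℝ) : ℝ :=
  ∑ j, M.alloc x' j * x j - M.pay x'

/-- Allocations are probabilities and payments are nonnegative. -/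
def IsValid (M : Mechanism m) : Prop :=
  ∀ x ∈ valuationSpace m, (∀ j, M.alloc x j ∈ Set.Icc (0 : ℝ) 1) ∧ 0 ≤ M.pay x

/-- Individual rationality. -/
def IsIR (M : Mechanism m) : Prop :=
  ∀ x ∈ valuationSpace m, 0 ≤ M.utility x x

/-- Incentive compatibility (truthfulness). -/
def IsIC (M : Mechanism m) : Prop :=
  ∀ x ∈ valuationSpace m, ∀ x' ∈ valuationSpace m, M.utility x' x ≤ M.utility x x

/-- The mechanisms over which revenue is maximized: possibly randomized, truthful and
individually rational. -/
def IsFeasible (M : Mechanism m) : Prop :=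
  M.IsValid ∧ M.IsIR ∧ M.IsIC

/-- Expected revenue when the values are drawn from `F`. -/
def revenue (M : Mechanism m) (F : Measure (Fin m → ℝ)) : ℝ :=
  ∫ x, M.pay x ∂F

/-- `M` is feasible and no feasible mechanism has larger expected revenue. -/
def IsOptimal (M : Mechanism m) (F : Measure (Fin m → ℝ)) : Prop :=
  M.IsFeasible ∧ ∀ M' : Mechanism m, M'.IsFeasible → M'.revenue F ≤ M.revenue F

open Classical in
/-- Deterministic full bundling: all goods are offered together, take it or leave it, at the
price `q`. -/
def fullBundle (m : ℕ) (q : ℝ) : Mechanism m where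
  alloc x _ := if q ≤ ∑ j, x j then 1 else 0
  pay x := if q ≤ ∑ j, x j then q else 0

end Mechanism

/-- The partial derivative of `u` in the coordinate `j`.  It is only used at almost every point
and for convex `u`, which are almost everywhere differentiable. -/
def partialD {m : ℕ} (u : (Fin m → ℝ) → ℝ) (j : Fin m) (x : Fin m → ℝ) : ℝ :=
  fderiv ℝ u x (Pi.single j 1)

/-- Nonnegative convex functions on the valuation space all of whose partial derivatives lie in
`[0, 1]` almost everywhere: the feasible utility functions. -/
def IsFeasibleUtility {m : ℕ} (u : (Fin m → ℝ) → ℝ) : Prop :=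
  ConvexOn ℝ (valuationSpace m) u ∧
  (∀ x ∈ valuationSpace m, 0 ≤ u x) ∧
  ∀ᵐ x ∂(volume.restrict (valuationSpace m)), ∀ j, partialD u j x ∈ Set.Icc (0 : ℝ) 1

/-- The revenue functional `R(u; F) = ∫ (∇u(x) · x - u(x)) dF(x)`. -/
def utilityRevenue {m : ℕ} (u : (Fin m → ℝ) → ℝ) (F : Measure (Fin m → ℝ)) : ℝ :=
  ∫ x, (∑ j, partialD u j x * x j - u x) ∂F

end

/-!
Under the law of `m` independent exponential values, the direction of `x` is independent of
`s = l * ∑ j, x j`, which is Gamma distributed with shape `m`. Hence `R(u; F)` is the average over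
rays of the revenue `∫₀^∞ s^(m-1) e^(-s) (s v'(s) - v(s)) ds / Γ(m)` of a seller of one good, where
`v` is `u` along the ray, a convex function with `0 ≤ v' ≤ 1/l`.

For every constant `k` this integrand is the derivative of `(v(s) - k s) Γ(m, s)` minus
`(k - v'(s)) g(m, s)`. Since `g(m, ·)` is negative before its root `γ` and positive after it,
`k = 0` on `[0, γ]` and `k = 1/l` on `[γ, ∞)` bound the integral by `γ Γ(m, γ) / l`, which is
`Γ(m)` times the revenue of bundling at price `γ / l`. Bundling at price `w / l` earns
`w Γ(m, w) / (l Γ(m))`, whose derivative in `w` has the sign of `-g(m, w)`; so no other price does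
as well. Finally, the utility function of a truthful mechanism is convex with gradient the
allocation, so that its payment is `∇u(x) · x - u(x)` almost everywhere.
-/

open scoped ENNReal

/-! ### The incomplete Gamma function and the root of `g` -/

theorem integrableOn_pow_mul_exp_neg (n : ℕ) (w : ℝ) :
    IntegrableOn (fun t : ℝ => t ^ n * Real.exp (-t)) (Set.Ioi w) := by
  refine integrable_of_isBigO_exp_neg one_half_pos (by fun_prop) ?_
  simpa only [mul_comm, Real.rpow_natCast] using (Real.Gamma_integrand_isLittleO n).isBigO

theorem upperGamma_eq_sub (m : ℕ) (w : ℝ) :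
    upperGamma m w = upperGamma m 0 - ∫ t in (0 : ℝ)..w, t ^ (m - 1) * Real.exp (-t) := by
  have h := intervalIntegral.integral_Ioi_sub_Ioi'
    (integrableOn_pow_mul_exp_neg (m - 1) 0) (integrableOn_pow_mul_exp_neg (m - 1) w)
  rw [upperGamma, upperGamma, ← h, sub_sub_cancel]

theorem hasDerivAt_upperGamma (m : ℕ) (w : ℝ) :
    HasDerivAt (upperGamma m) (-(w ^ (m - 1) * Real.exp (-w))) w := by
  rw [funext (upperGamma_eq_sub m)]
  have hc : Continuous fun t : ℝ => t ^ (m - 1) * Real.exp (-t) := by fun_prop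
  exact (hc.integral_hasStrictDerivAt 0 w).hasDerivAt.const_sub _

theorem contDiff_upperGamma (m : ℕ) : ContDiff ℝ 1 (upperGamma m) := by
  refine contDiff_one_iff_deriv.2 ⟨fun w => (hasDerivAt_upperGamma m w).differentiableAt, ?_⟩
  rw [funext fun w => (hasDerivAt_upperGamma m w).deriv]
  fun_prop

theorem continuous_upperGamma (m : ℕ) : Continuous (upperGamma m) :=
  (contDiff_upperGamma m).continuous

theorem upperGamma_pos (m : ℕ) {w : ℝ} (hw : 0 ≤ w) : 0 < upperGamma m w := by
  rw [upperGamma, setIntegral_pos_iff_support_of_nonneg_ae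
    (ae_restrict_of_forall_mem measurableSet_Ioi fun t ht => ?_) (integrableOn_pow_mul_exp_neg _ w)]
  · have hsupp : Set.Ioi w ⊆ (Function.support fun t : ℝ => t ^ (m - 1) * Real.exp (-t)) :=
      fun t ht => (mul_pos (pow_pos (hw.trans_lt ht) _) (Real.exp_pos _)).ne'
    rw [Set.inter_eq_self_of_subset_right hsupp, Real.volume_Ioi]
    exact ENNReal.zero_lt_top
  · exact mul_nonneg (pow_nonneg (hw.trans (le_of_lt ht)) _) (Real.exp_pos _).le

theorem tendsto_upperGamma_atTop (m : ℕ) :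
    Filter.Tendsto (upperGamma m) Filter.atTop (nhds 0) :=
  tendsto_integral_Ioi_zero Filter.tendsto_id

theorem upperGamma_succ (m : ℕ) (w : ℝ) :
    upperGamma (m + 1) w = m * upperGamma m w + w ^ m * Real.exp (-w) := by
  have hderiv (t : ℝ) : HasDerivAt (fun t : ℝ => -(t ^ m * Real.exp (-t)))
      (t ^ m * Real.exp (-t) - m * (t ^ (m - 1) * Real.exp (-t))) t :=
    ((hasDerivAt_pow m t).mul (hasDerivAt_neg t).exp).neg.congr_deriv (by ring)
  have hint := integrableOn_pow_mul_exp_neg m w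
  have hint' := (integrableOn_pow_mul_exp_neg (m - 1) w).const_mul (m : ℝ)
  have hlim : Filter.Tendsto (fun t : ℝ => -(t ^ m * Real.exp (-t))) Filter.atTop (nhds 0) := by
    simpa only [neg_zero] using (Real.tendsto_pow_mul_exp_neg_atTop_nhds_zero m).neg
  have h := integral_Ioi_of_hasDerivAt_of_tendsto' (fun t _ => hderiv t) (hint.sub hint') hlim
  rw [integral_sub hint hint', integral_const_mul] at h
  simp only [upperGamma, Nat.add_sub_cancel]
  linarith

theorem gFun_eq (m : ℕ) (w : ℝ) : gFun m w = w ^ m * Real.exp (-w) - upperGamma m w := by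
  rw [gFun, upperGamma_succ]
  ring

theorem hasDerivAt_mul_upperGamma {m : ℕ} (hm : 0 < m) (w : ℝ) :
    HasDerivAt (fun w => w * upperGamma m w) (-gFun m w) w := by
  refine ((hasDerivAt_id w).mul (hasDerivAt_upperGamma m w)).congr_deriv ?_
  rw [gFun_eq, ← mul_pow_sub_one hm.ne' w, id]
  ring

theorem hasDerivAt_gFun {m : ℕ} (hm : 0 < m) (w : ℝ) :
    HasDerivAt (gFun m) (w ^ (m - 1) * Real.exp (-w) * (m + 1 - w)) w := by
  rw [funext (gFun_eq m)]
  refine (((hasDerivAt_pow m w).mul (hasDerivAt_neg w).exp).sub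
    (hasDerivAt_upperGamma m w)).congr_deriv ?_
  rw [← mul_pow_sub_one hm.ne' w]
  ring

theorem continuous_gFun (m : ℕ) : Continuous (gFun m) := by
  unfold gFun
  exact (continuous_upperGamma _).sub ((continuous_upperGamma _).const_mul _)

theorem strictMonoOn_gFun {m : ℕ} (hm : 0 < m) : StrictMonoOn (gFun m) (Set.Icc 0 (m + 1)) := by
  refine strictMonoOn_of_hasDerivWithinAt_pos (convex_Icc _ _) (continuous_gFun m).continuousOn
    (fun w _ => (hasDerivAt_gFun hm w).hasDerivWithinAt) fun w hw => ?_
  rw [interior_Icc] at hw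
  have hw₀ : 0 < w := hw.1
  have hw₁ : 0 < m + 1 - w := sub_pos.2 hw.2
  positivity

theorem gFun_zero_neg {m : ℕ} (hm : 0 < m) : gFun m 0 < 0 := by
  rw [gFun_eq, zero_pow hm.ne', zero_mul, zero_sub, neg_lt_zero]
  exact upperGamma_pos m le_rfl

theorem gFun_pos_of_le {m : ℕ} (hm : 0 < m) {w : ℝ} (hw : m + 1 ≤ w) : 0 < gFun m w := by
  have hanti : StrictAntiOn (gFun m) (Set.Ici (m + 1)) := by
    refine strictAntiOn_of_hasDerivWithinAt_neg (convex_Ici _) (continuous_gFun m).continuousOn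
      (fun w _ => (hasDerivAt_gFun hm w).hasDerivWithinAt) fun w hw => ?_
    rw [interior_Ici, Set.mem_Ioi] at hw
    have hw₀ : 0 < w := lt_trans (by positivity) hw
    exact mul_neg_of_pos_of_neg (by positivity) (sub_neg.2 hw)
  have hlim : Filter.Tendsto (gFun m) Filter.atTop (nhds 0) := by
    rw [funext (gFun_eq m)]
    simpa only [sub_zero] using
      (Real.tendsto_pow_mul_exp_neg_atTop_nhds_zero m).sub (tendsto_upperGamma_atTop m)
  have hnext : 0 ≤ gFun m (w + 1) := by
    refine le_of_tendsto hlim ?_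
    filter_upwards [Filter.eventually_ge_atTop (w + 1)] with t ht
    exact hanti.antitoneOn (Set.mem_Ici.2 (by linarith)) (Set.mem_Ici.2 (by linarith)) ht
  exact hnext.trans_lt (hanti hw (Set.mem_Ici.2 (by linarith)) (lt_add_one w))

theorem exists_gFun_eq_zero {m : ℕ} (hm : 0 < m) : ∃ γ, 0 < γ ∧ gFun m γ = 0 := by
  have hm₁ : (0 : ℝ) ≤ m + 1 := by positivity
  obtain ⟨γ, hγ, hroot⟩ := intermediate_value_Ioo hm₁ (continuous_gFun m).continuousOn
    ⟨gFun_zero_neg hm, gFun_pos_of_le hm le_rfl⟩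
  exact ⟨γ, hγ.1, hroot⟩

section Root

variable {m : ℕ} {γ w : ℝ}

theorem gFun_neg_of_lt_root (hm : 0 < m) (hroot : gFun m γ = 0) (hw : 0 ≤ w) (hwγ : w < γ) :
    gFun m w < 0 := by
  have hγ : γ < m + 1 := not_le.1 fun h => (gFun_pos_of_le hm h).ne' hroot
  rw [← hroot]
  exact strictMonoOn_gFun hm ⟨hw, hwγ.le.trans hγ.le⟩ ⟨hw.trans hwγ.le, hγ.le⟩ hwγ

theorem gFun_pos_of_root_lt (hm : 0 < m) (hγ : 0 ≤ γ) (hroot : gFun m γ = 0) (hγw : γ < w) :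
    0 < gFun m w := by
  rcases le_total (m + 1 : ℝ) w with hw | hw
  · exact gFun_pos_of_le hm hw
  · rw [← hroot]
    exact strictMonoOn_gFun hm ⟨hγ, hγw.le.trans hw⟩ ⟨hγ.trans hγw.le, hw⟩ hγw

theorem gFun_nonpos_of_le_root (hm : 0 < m) (hroot : gFun m γ = 0) (hw : 0 ≤ w) (hwγ : w ≤ γ) :
    gFun m w ≤ 0 := by
  rcases hwγ.eq_or_lt with rfl | h
  · exact hroot.le
  · exact (gFun_neg_of_lt_root hm hroot hw h).le

theorem gFun_nonneg_of_root_le (hm : 0 < m) (hγ : 0 ≤ γ) (hroot : gFun m γ = 0) (hγw : γ ≤ w) :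
    0 ≤ gFun m w := by
  rcases hγw.eq_or_lt with rfl | h
  · exact hroot.ge
  · exact (gFun_pos_of_root_lt hm hγ hroot h).le

theorem eq_of_gFun_eq_zero (hm : 0 < m) (hγ : 0 ≤ γ) (hroot : gFun m γ = 0) (hw : 0 ≤ w)
    (hw_root : gFun m w = 0) : w = γ := by
  rcases lt_trichotomy w γ with h | h | h
  · exact absurd hw_root (gFun_neg_of_lt_root hm hroot hw h).ne
  · exact h
  · exact absurd hw_root (gFun_pos_of_root_lt hm hγ hroot h).ne'

theorem mul_upperGamma_lt (hm : 0 < m) (hγ : 0 ≤ γ) (hroot : gFun m γ = 0) (hw : 0 ≤ w)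
    (hne : w ≠ γ) : w * upperGamma m w < γ * upperGamma m γ := by
  have hcont : Continuous fun w => w * upperGamma m w :=
    continuous_id.mul (continuous_upperGamma m)
  have hderiv (t : ℝ) := hasDerivAt_mul_upperGamma hm t
  rcases hne.lt_or_gt with h | h
  · refine strictMonoOn_of_hasDerivWithinAt_pos (convex_Icc 0 γ) hcont.continuousOn
      (fun t _ => (hderiv t).hasDerivWithinAt) (fun t ht => ?_) ⟨hw, h.le⟩ ⟨hγ, le_rfl⟩ h
    rw [interior_Icc] at ht
    exact neg_pos.2 (gFun_neg_of_lt_root hm hroot ht.1.le ht.2)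
  · refine strictAntiOn_of_hasDerivWithinAt_neg (convex_Ici γ) hcont.continuousOn
      (fun t _ => (hderiv t).hasDerivWithinAt) (fun t ht => ?_) Set.self_mem_Ici h.le h
    rw [interior_Ici] at ht
    exact neg_neg_of_pos (gFun_pos_of_root_lt hm hγ hroot ht)

end Root

/-! ### Product densities and Gamma densities -/

theorem lintegral_fin_nat_prod_eq_prod {n : ℕ} {α : Fin n → Type*} [∀ i, MeasurableSpace (α i)]
    (μ : ∀ i, Measure (α i)) [∀ i, SigmaFinite (μ i)] {f : ∀ i, α i → ℝ≥0∞}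
    (hf : ∀ i, Measurable (f i)) :
    ∫⁻ x, ∏ i, f i (x i) ∂Measure.pi μ = ∏ i, ∫⁻ x, f i x ∂μ i := by
  induction n with
  | zero => simp
  | succ n ih =>
    calc ∫⁻ x, ∏ i, f i (x i) ∂Measure.pi μ
        = ∫⁻ p : α 0 × (∀ i : Fin n, α i.succ), f 0 p.1 * ∏ i, f (Fin.succ i) (p.2 i)
            ∂(μ 0).prod (Measure.pi fun i : Fin n => μ i.succ) := by
          rw [← ((measurePreserving_piFinSuccAbove μ 0).symm).lintegral_comp_emb
            (MeasurableEquiv.measurableEmbedding _)]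
          refine lintegral_congr fun p => ?_
          rw [Fin.prod_univ_succ]
          rfl
      _ = (∫⁻ x, f 0 x ∂μ 0) * ∏ i : Fin n, ∫⁻ x, f i.succ x ∂μ i.succ := by
          rw [← ih (fun i : Fin n => μ i.succ) fun i => hf i.succ]
          exact lintegral_prod_mul (hf 0).aemeasurable
            (Finset.measurable_prod _ fun i _ =>
              (hf (Fin.succ i)).comp (measurable_pi_apply i)).aemeasurable
      _ = ∏ i, ∫⁻ x, f i x ∂μ i :=
          (Fin.prod_univ_succ fun i => ∫⁻ x, f i x ∂μ i).symm

section Pi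

variable {ι : Type*} [Fintype ι] {α : ι → Type*} [∀ i, MeasurableSpace (α i)]
  (μ : ∀ i, Measure (α i)) [∀ i, SigmaFinite (μ i)] {f : ∀ i, α i → ℝ≥0∞}

theorem lintegral_fintype_prod_eq_prod (hf : ∀ i, Measurable (f i)) :
    ∫⁻ x, ∏ i, f i (x i) ∂Measure.pi μ = ∏ i, ∫⁻ x, f i x ∂μ i := by
  let e := (Fintype.equivFin ι).symm
  rw [← (measurePreserving_piCongrLeft μ e).lintegral_comp_emb
    (MeasurableEquiv.measurableEmbedding _)]
  simp_rw [← e.prod_comp, MeasurableEquiv.coe_piCongrLeft, Equiv.piCongrLeft_apply_apply]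
  exact lintegral_fin_nat_prod_eq_prod (fun i => μ (e i)) fun i => hf (e i)

theorem pi_withDensity [∀ i, SigmaFinite ((μ i).withDensity (f i))] (hf : ∀ i, Measurable (f i)) :
    Measure.pi (fun i => (μ i).withDensity (f i)) =
      (Measure.pi μ).withDensity fun x => ∏ i, f i (x i) := by
  refine Measure.pi_eq fun s hs => ?_
  have hbox (x : ∀ i, α i) : (Set.univ.pi s).indicator (fun x => ∏ i, f i (x i)) x =
      ∏ i, (s i).indicator (f i) (x i) := by
    classical
    simp only [Set.indicator_apply, Set.mem_univ_pi, Finset.prod_ite_zero, Finset.mem_univ,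
      forall_const]
  rw [withDensity_apply _ (MeasurableSet.univ_pi hs),
    ← lintegral_indicator (MeasurableSet.univ_pi hs), funext hbox,
    lintegral_fintype_prod_eq_prod μ fun i => (hf i).indicator (hs i)]
  refine Finset.prod_congr rfl fun i _ => ?_
  rw [lintegral_indicator (hs i), withDensity_apply _ (hs i)]

end Pi

theorem lintegral_comp_smul_addHaar {E : Type*} [NormedAddCommGroup E] [NormedSpace ℝ E]
    [FiniteDimensional ℝ E] [MeasurableSpace E] [BorelSpace E] (μ : Measure E)
    [μ.IsAddHaarMeasure] (h : E → ℝ≥0∞) {r : ℝ} (hr : 0 < r) :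
    ∫⁻ x, h x ∂μ = ENNReal.ofReal (r ^ Module.finrank ℝ E) * ∫⁻ y, h (r • y) ∂μ := by
  have hpow : 0 < r ^ Module.finrank ℝ E := pow_pos hr _
  have hmap := lintegral_map_equiv (μ := μ) h (MeasurableEquiv.smul₀ r hr.ne')
  rw [MeasurableEquiv.coe_smul₀] at hmap
  rw [← hmap, Measure.map_addHaar_smul μ hr.ne', lintegral_smul_measure, smul_eq_mul, ← mul_assoc,
    ← ENNReal.ofReal_mul hpow.le, abs_of_pos (inv_pos.2 hpow), mul_inv_cancel₀ hpow.ne',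
    ENNReal.ofReal_one, one_mul]

theorem lintegral_Ioi_zero_comp_div (φ : ℝ → ℝ≥0∞) {c : ℝ} (hc : 0 < c) :
    ∫⁻ s in Set.Ioi 0, φ s = ∫⁻ r in Set.Ioi 0, ENNReal.ofReal (c / r ^ 2) * φ (c / r) := by
  have himage : (fun r => c / r) '' Set.Ioi 0 = Set.Ioi 0 := by
    ext s
    refine ⟨?_, fun hs => ⟨c / s, div_pos hc hs, div_div_cancel₀ hc.ne'⟩⟩
    rintro ⟨r, hr, rfl⟩
    exact div_pos hc hr
  have hinj : Set.InjOn (fun r => c / r) (Set.Ioi 0) := fun a _ b _ hab => by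
    rw [← div_div_cancel₀ (b := a) hc.ne', ← div_div_cancel₀ (b := b) hc.ne']
    exact congrArg (c / ·) hab
  have hderiv : ∀ r ∈ Set.Ioi (0 : ℝ),
      HasDerivWithinAt (fun r => c / r) (-(c / r ^ 2)) (Set.Ioi 0) r := fun r hr =>
    (((hasDerivAt_inv (ne_of_gt hr)).const_mul c).congr_deriv (by ring)).hasDerivWithinAt
  have h := lintegral_image_eq_lintegral_abs_deriv_mul measurableSet_Ioi hderiv hinj φ
  rw [himage] at h
  rw [h]
  refine setLIntegral_congr_fun measurableSet_Ioi fun r _ => ?_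
  simp only [abs_neg, abs_of_nonneg (div_nonneg hc.le (sq_nonneg r))]

theorem integrable_id_gammaMeasure {a r : ℝ} (ha : 0 < a) (hr : 0 < r) :
    Integrable (fun x => x) (gammaMeasure a r) := by
  have hpdf (x : ℝ) : gammaPDF a r x * ‖x‖ₑ = ENNReal.ofReal (a / r) * gammaPDF (a + 1) r x := by
    rcases lt_or_ge x 0 with hx | hx
    · simp only [gammaPDF_of_neg hx, zero_mul, mul_zero]
    · have hmul : x ^ (a - 1) * x = x ^ a := by
        rw [← Real.rpow_add_one' hx (by simpa only [sub_add_cancel] using ha.ne'), sub_add_cancel]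
      rw [gammaPDF_of_nonneg hx, gammaPDF_of_nonneg hx, Real.enorm_of_nonneg hx,
        ← ENNReal.ofReal_mul (by positivity), ← ENNReal.ofReal_mul (by positivity),
        Real.Gamma_add_one ha.ne', Real.rpow_add_one hr.ne', add_sub_cancel_right, ← hmul]
      have := (Real.Gamma_pos_of_pos ha).ne'
      field_simp
  refine ⟨by fun_prop, ?_⟩
  rw [hasFiniteIntegral_iff_enorm, gammaMeasure,
    lintegral_withDensity_eq_lintegral_mul _ (f := gammaPDF a r)
      (measurable_gammaPDFReal a r).ennreal_ofReal (by fun_prop)]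
  simp only [Pi.mul_apply, hpdf]
  rw [lintegral_const_mul (f := gammaPDF (a + 1) r) _ (measurable_gammaPDFReal _ r).ennreal_ofReal,
    lintegral_gammaPDF_eq_one (by positivity) hr, mul_one]
  exact ENNReal.ofReal_lt_top

theorem gammaMeasure_eq_withDensity_restrict_Ioi (a r : ℝ) :
    gammaMeasure a r = (volume.restrict (Set.Ioi 0)).withDensity (gammaPDF a r) := by
  have hae : (Set.Ici 0).indicator (gammaPDF a r) = gammaPDF a r :=
    Set.indicator_eq_self.2 fun x hx => not_lt.1 fun h => hx (gammaPDF_of_neg h)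
  rw [gammaMeasure, restrict_Ioi_eq_restrict_Ici, ← withDensity_indicator measurableSet_Ici, hae]

theorem gammaPDFReal_natCast_one {m : ℕ} (hm : 0 < m) {s : ℝ} (hs : 0 ≤ s) :
    gammaPDFReal m 1 s = s ^ (m - 1) * Real.exp (-s) / Real.Gamma m := by
  rw [gammaPDFReal, if_pos hs, ← Nat.cast_pred hm, Real.rpow_natCast s, Real.one_rpow, one_mul]
  ring

theorem setLIntegral_Ioi_gammaPDF {a r : ℝ} (ha : 0 < a) (hr : 0 < r) :
    ∫⁻ x in Set.Ioi 0, gammaPDF a r x = 1 := by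
  have := isProbabilityMeasure_gammaMeasure ha hr
  rw [← setLIntegral_univ, ← withDensity_apply _ MeasurableSet.univ,
    ← gammaMeasure_eq_withDensity_restrict_Ioi, measure_univ]

theorem measurable_gammaPDF_uncurry (a : ℝ) :
    Measurable fun p : ℝ × ℝ => gammaPDF a p.1 p.2 := by
  unfold gammaPDF gammaPDFReal
  exact (Measurable.ite (measurableSet_Ici.preimage measurable_snd) (by fun_prop)
    measurable_const).ennreal_ofReal

theorem toReal_gammaPDF_natCast_one {m : ℕ} (hm : 0 < m) {s : ℝ} (hs : 0 < s) :
    (gammaPDF m 1 s).toReal = s ^ (m - 1) * Real.exp (-s) / Real.Gamma m := by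
  have : 0 < Real.Gamma m := Real.Gamma_pos_of_pos (by positivity)
  rw [gammaPDF, gammaPDFReal_natCast_one hm hs.le, ENNReal.toReal_ofReal (by positivity)]

theorem integral_gammaMeasure {m : ℕ} (hm : 0 < m) (f : ℝ → ℝ) :
    ∫ s, f s ∂gammaMeasure m 1 =
      (∫ s in Set.Ioi 0, s ^ (m - 1) * Real.exp (-s) * f s) / Real.Gamma m := by
  rw [gammaMeasure_eq_withDensity_restrict_Ioi, integral_withDensity_eq_integral_toReal_smul
    (f := gammaPDF m 1) (measurable_gammaPDFReal _ _).ennreal_ofReal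
    (ae_of_all _ fun _ => ENNReal.ofReal_lt_top), ← integral_div]
  refine setIntegral_congr_fun measurableSet_Ioi fun s hs => ?_
  rw [toReal_gammaPDF_natCast_one hm hs, smul_eq_mul, div_mul_eq_mul_div]

theorem integrable_gammaMeasure_iff {m : ℕ} (hm : 0 < m) (f : ℝ → ℝ) :
    Integrable f (gammaMeasure m 1) ↔
      IntegrableOn (fun s => s ^ (m - 1) * Real.exp (-s) * f s) (Set.Ioi 0) := by
  have hΓ : Real.Gamma m ≠ 0 := (Real.Gamma_pos_of_pos (by positivity)).ne'
  have hcongr : Set.EqOn (fun s => (gammaPDF m 1 s).toReal • f s)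
      (fun s => s ^ (m - 1) * Real.exp (-s) * f s / Real.Gamma m) (Set.Ioi 0) := fun s hs => by
    simp only [toReal_gammaPDF_natCast_one hm hs, smul_eq_mul, div_mul_eq_mul_div]
  rw [gammaMeasure_eq_withDensity_restrict_Ioi, integrable_withDensity_iff_integrable_smul'
    (f := gammaPDF m 1) (measurable_gammaPDFReal _ _).ennreal_ofReal
    (ae_of_all _ fun _ => ENNReal.ofReal_lt_top), ← IntegrableOn,
    integrableOn_congr_fun hcongr measurableSet_Ioi, IntegrableOn, IntegrableOn]
  simp only [div_eq_mul_inv]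
  exact integrable_mul_const_iff (inv_ne_zero hΓ).isUnit _

theorem gammaMeasure_real_Ici {m : ℕ} (hm : 0 < m) {w : ℝ} (hw : 0 ≤ w) :
    (gammaMeasure m 1).real (Set.Ici w) = upperGamma m w / Real.Gamma m := by
  have hset : (Set.Ioi 0 ∩ Set.Ici w : Set ℝ) =ᵐ[volume] Set.Ioi w := by
    have h := (ae_eq_refl (μ := volume) (Set.Ioi (0 : ℝ))).inter
      (Ioi_ae_eq_Ici (μ := volume) (a := w)).symm
    rwa [Set.Ioi_inter_Ioi, max_eq_right hw] at h
  rw [← integral_indicator_one measurableSet_Ici, integral_gammaMeasure hm]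
  have hdensity : (fun s : ℝ => s ^ (m - 1) * Real.exp (-s) * (Set.Ici w).indicator 1 s) =
      (Set.Ici w).indicator fun s => s ^ (m - 1) * Real.exp (-s) := by
    ext s
    rw [Set.indicator_apply, Set.indicator_apply, mul_ite, Pi.one_apply, mul_one, mul_zero]
  rw [hdensity, setIntegral_indicator measurableSet_Ici, setIntegral_congr_set hset, upperGamma]

theorem restrict_Ioi_absolutelyContinuous_gammaMeasure {a r : ℝ} (ha : 0 < a) (hr : 0 < r) :
    volume.restrict (Set.Ioi 0) ≪ gammaMeasure a r := by
  rw [gammaMeasure_eq_withDensity_restrict_Ioi]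
  refine withDensity_absolutelyContinuous'
    (measurable_gammaPDFReal _ _).ennreal_ofReal.aemeasurable ?_
  filter_upwards [ae_restrict_mem measurableSet_Ioi] with s hs
  exact (ENNReal.ofReal_pos.2 (gammaPDFReal_pos ha hr hs)).ne'

/-! ### The law of the values -/

theorem valuationSpace_eq_Ici (m : ℕ) : valuationSpace m = Set.Ici 0 := by
  ext x
  simp only [valuationSpace, Set.mem_ofPred_eq, Set.mem_Ici, Pi.le_def, Pi.zero_apply]

theorem measurableSet_valuationSpace (m : ℕ) : MeasurableSet (valuationSpace m) := by
  rw [valuationSpace_eq_Ici]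
  exact measurableSet_Ici

theorem convex_valuationSpace (m : ℕ) : Convex ℝ (valuationSpace m) := by
  rw [valuationSpace_eq_Ici]
  exact convex_Ici 0

theorem interior_valuationSpace (m : ℕ) : interior (valuationSpace m) = {x | ∀ j, 0 < x j} := by
  rw [valuationSpace_eq_Ici, ← Set.pi_univ_Ici, interior_pi_set Set.finite_univ]
  ext x
  simp only [interior_Ici, Set.mem_univ_pi, Pi.zero_apply, Set.mem_Ioi, Set.mem_ofPred_eq]

theorem restrict_interior_valuationSpace (m : ℕ) :
    volume.restrict (interior (valuationSpace m)) = volume.restrict (valuationSpace m) :=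
  Measure.restrict_congr_set (interior_ae_eq_of_null_frontier
    ((convex_valuationSpace m).addHaar_frontier volume))

theorem ae_mem_interior_valuationSpace (m : ℕ) :
    ∀ᵐ x ∂volume.restrict (valuationSpace m), x ∈ interior (valuationSpace m) := by
  rw [← restrict_interior_valuationSpace]
  exact ae_restrict_mem isOpen_interior.measurableSet

theorem smul_mem_valuationSpace {m : ℕ} {x : Fin m → ℝ} (hx : x ∈ valuationSpace m) {t : ℝ}
    (ht : 0 ≤ t) : t • x ∈ valuationSpace m :=
  fun j => mul_nonneg ht (hx j)

theorem sum_nonneg_of_mem_valuationSpace {m : ℕ} {x : Fin m → ℝ} (hx : x ∈ valuationSpace m) :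
    0 ≤ ∑ j, x j :=
  Finset.sum_nonneg fun j _ => hx j

theorem ae_sum_pos {m : ℕ} (hm : 0 < m) :
    ∀ᵐ x ∂volume.restrict (valuationSpace m), 0 < ∑ j, x j := by
  filter_upwards [ae_mem_interior_valuationSpace m] with x hx
  rw [interior_valuationSpace] at hx
  exact Finset.sum_pos (fun j _ => hx j) ⟨⟨0, hm⟩, Finset.mem_univ _⟩

/-- The joint density of `m` independent exponential values with common parameter `l`. -/
noncomputable def iidExpPDF (m : ℕ) (l : ℝ) (x : Fin m → ℝ) : ℝ≥0∞ :=
  ∏ j, exponentialPDF l (x j)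

theorem measurable_iidExpPDF (m : ℕ) (l : ℝ) : Measurable (iidExpPDF m l) :=
  Finset.measurable_prod _ fun j _ =>
    (measurable_exponentialPDFReal l).ennreal_ofReal.comp (measurable_pi_apply j)

theorem iidExpPDF_of_mem {m : ℕ} {l : ℝ} (hl : 0 < l) {x : Fin m → ℝ} (hx : x ∈ valuationSpace m) :
    iidExpPDF m l x = ENNReal.ofReal (l ^ m * Real.exp (-(l * ∑ j, x j))) := by
  have hpdf (j : Fin m) : exponentialPDF l (x j) = ENNReal.ofReal (l * Real.exp (-(l * x j))) := by
    rw [exponentialPDF_eq, if_pos (hx j)]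
  rw [iidExpPDF, Finset.prod_congr rfl fun j _ => hpdf j,
    ← ENNReal.ofReal_prod_of_nonneg fun j _ => by positivity, Finset.prod_mul_distrib,
    Finset.prod_const, Finset.card_univ, Fintype.card_fin, ← Real.exp_sum,
    Finset.sum_neg_distrib, Finset.mul_sum]

theorem iidExpPDF_of_notMem {m : ℕ} (l : ℝ) {x : Fin m → ℝ} (hx : x ∉ valuationSpace m) :
    iidExpPDF m l x = 0 := by
  obtain ⟨j, hj⟩ := not_forall.1 hx
  refine Finset.prod_eq_zero (Finset.mem_univ j) ?_
  rw [exponentialPDF_eq, if_neg hj, ENNReal.ofReal_zero]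

section IidExp

variable (m : ℕ) {l : ℝ}

theorem isProbabilityMeasure_iidExp (hl : 0 < l) : IsProbabilityMeasure (iidExp m l) := by
  have := isProbabilityMeasure_expMeasure hl
  unfold iidExp
  infer_instance

theorem iidExp_eq_withDensity (hl : 0 < l) :
    iidExp m l = volume.withDensity (iidExpPDF m l) := by
  have : IsProbabilityMeasure (volume.withDensity (exponentialPDF l)) :=
    isProbabilityMeasure_expMeasure hl
  exact pi_withDensity (fun _ => volume) (f := fun _ => exponentialPDF l) fun _ =>
    (measurable_exponentialPDFReal l).ennreal_ofReal

theorem lintegral_iidExp (hl : 0 < l) {f : (Fin m → ℝ) → ℝ≥0∞} (hf : Measurable f) :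
    ∫⁻ x, f x ∂iidExp m l = ∫⁻ x, iidExpPDF m l x * f x := by
  rw [iidExp_eq_withDensity m hl, lintegral_withDensity_eq_lintegral_mul _
    (measurable_iidExpPDF m l) hf]
  rfl

theorem iidExp_absolutelyContinuous (hl : 0 < l) :
    iidExp m l ≪ volume.restrict (valuationSpace m) := by
  have hind : (valuationSpace m).indicator (iidExpPDF m l) = iidExpPDF m l :=
    Set.indicator_eq_self.2 fun x hx => not_imp_comm.1 (iidExpPDF_of_notMem l) hx
  rw [iidExp_eq_withDensity m hl, ← hind, withDensity_indicator (measurableSet_valuationSpace m)]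
  exact withDensity_absolutelyContinuous _ _

theorem ae_iidExp_mem_valuationSpace (hl : 0 < l) : ∀ᵐ x ∂iidExp m l, x ∈ valuationSpace m :=
  (iidExp_absolutelyContinuous m hl).ae_le (ae_restrict_mem (measurableSet_valuationSpace m))

theorem integrable_sum_iidExp (hl : 0 < l) : Integrable (fun x => ∑ j, x j) (iidExp m l) := by
  have := isProbabilityMeasure_expMeasure hl
  exact integrable_finsetSum _ fun j _ =>
    integrable_comp_eval (μ := fun _ => expMeasure l) (f := fun t => t)
      (integrable_id_gammaMeasure one_pos hl)

end IidExp

/-! ### Redrawing the total value -/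

/-- The point at which the ray through `x` has total value `s / l`; it serves to redraw the total
value of `x` while keeping its direction. With the normalization by `l`, the parameter `s` stands
for `l * ∑ j, x j`, whose law does not depend on `l`. -/
noncomputable def rescaleTotal {m : ℕ} (l : ℝ) (x : Fin m → ℝ) (s : ℝ) : Fin m → ℝ :=
  (s / (l * ∑ j, x j)) • x

theorem measurable_rescaleTotal (m : ℕ) (l : ℝ) :
    Measurable fun p : (Fin m → ℝ) × ℝ => rescaleTotal l p.1 p.2 := by
  unfold rescaleTotal
  fun_prop

theorem sum_rescaleTotal {m : ℕ} {l : ℝ} (hl : 0 < l) {x : Fin m → ℝ} (hx : 0 < ∑ j, x j)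
    (s : ℝ) : ∑ j, rescaleTotal l x s j = s / l := by
  simp only [rescaleTotal, Pi.smul_apply, smul_eq_mul, ← Finset.mul_sum]
  field_simp

theorem lintegral_rescaleTotal {m : ℕ} {l : ℝ} (hl : 0 < l) {x : Fin m → ℝ} (hx : 0 < ∑ j, x j)
    {f : (Fin m → ℝ) → ℝ≥0∞} (hf : Measurable f) :
    ∫⁻ s, f (rescaleTotal l x s) ∂gammaMeasure m 1 =
      ∫⁻ r in Set.Ioi 0, ENNReal.ofReal (l * (∑ j, x j) / r ^ 2) *
        (gammaPDF m 1 (l * (∑ j, x j) / r) * f (r⁻¹ • x)) := by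
  have hc : 0 < l * ∑ j, x j := mul_pos hl hx
  have hmeas : Measurable fun s => f (rescaleTotal l x s) :=
    hf.comp ((measurable_rescaleTotal m l).comp measurable_prodMk_left)
  rw [gammaMeasure_eq_withDensity_restrict_Ioi, lintegral_withDensity_eq_lintegral_mul
    (f := gammaPDF m 1) _ (measurable_gammaPDFReal _ _).ennreal_ofReal hmeas,
    lintegral_Ioi_zero_comp_div _ hc]
  refine setLIntegral_congr_fun measurableSet_Ioi fun r _ => ?_
  rw [Pi.mul_apply, rescaleTotal, div_right_comm, div_self hc.ne', one_div]

-- In the variables `y = rescaleTotal l x s` and `r = l * ∑ j, x j / s`, the joint density of `x`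
-- and an independent Gamma variable `s` is the density of `y` times a conditional density of `r`
-- given `y`; integrating out `r` leaves the law of `y`.
theorem iidExpPDF_smul_mul_gammaPDF {m : ℕ} (hm : 0 < m) {l : ℝ} (hl : 0 < l) {y : Fin m → ℝ}
    (hy : y ∈ valuationSpace m → 0 < ∑ j, y j) {r : ℝ} (hr : 0 < r) :
    ENNReal.ofReal (r ^ m) * (iidExpPDF m l (r • y) *
        (ENNReal.ofReal (l * (∑ j, y j) / r) * gammaPDF m 1 (l * ∑ j, y j))) =
      iidExpPDF m l y * gammaPDF m (l * ∑ j, y j) r := by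
  by_cases hmem : y ∈ valuationSpace m
  · have hsum : ∑ j, (r • y) j = r * ∑ j, y j := by
      simp only [Pi.smul_apply, smul_eq_mul, Finset.mul_sum]
    have hc : 0 < l * ∑ j, y j := mul_pos hl (hy hmem)
    have : 0 < Real.Gamma m := Real.Gamma_pos_of_pos (by positivity)
    rw [iidExpPDF_of_mem hl hmem, iidExpPDF_of_mem hl (smul_mem_valuationSpace hmem hr.le), hsum,
      gammaPDF, gammaPDF, gammaPDFReal_natCast_one hm hc.le, gammaPDFReal, if_pos hr.le,
      ← Nat.cast_pred hm, Real.rpow_natCast, Real.rpow_natCast]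
    repeat rw [← ENNReal.ofReal_mul (by positivity)]
    congr 1
    rw [← mul_pow_sub_one hm.ne' r, ← mul_pow_sub_one hm.ne' (l * ∑ j, y j)]
    field_simp
  · have hsmul : r • y ∉ valuationSpace m := fun h => hmem <| by
      simpa only [inv_smul_smul₀ hr.ne'] using smul_mem_valuationSpace h (inv_nonneg.2 hr.le)
    simp only [iidExpPDF_of_notMem l hmem, iidExpPDF_of_notMem l hsmul, zero_mul, mul_zero]

theorem lintegral_iidExpPDF_mul_inv_smul {m : ℕ} (hm : 0 < m) {l : ℝ} (hl : 0 < l)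
    {f : (Fin m → ℝ) → ℝ≥0∞} (hf : Measurable f) {r : ℝ} (hr : 0 < r) :
    ∫⁻ x, iidExpPDF m l x * (ENNReal.ofReal (l * (∑ j, x j) / r ^ 2) *
        (gammaPDF m 1 (l * (∑ j, x j) / r) * f (r⁻¹ • x))) =
      ∫⁻ y, f y * (iidExpPDF m l y * gammaPDF m (l * ∑ j, y j) r) := by
  have hsum : ∀ᵐ y : Fin m → ℝ, y ∈ valuationSpace m → 0 < ∑ j, y j :=
    (ae_restrict_iff' (measurableSet_valuationSpace m)).1 (ae_sum_pos hm)
  have hpdf := measurable_iidExpPDF m l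
  have hgamma : Measurable (gammaPDF m 1) := (measurable_gammaPDFReal _ _).ennreal_ofReal
  rw [lintegral_comp_smul_addHaar volume _ hr, Module.finrank_fin_fun,
    ← lintegral_const_mul _ (by fun_prop)]
  refine lintegral_congr_ae ?_
  filter_upwards [hsum] with y hy
  have hsmul : l * ∑ j, (r • y) j = r * (l * ∑ j, y j) := by
    simp only [Pi.smul_apply, smul_eq_mul, ← Finset.mul_sum, mul_left_comm]
  rw [← iidExpPDF_smul_mul_gammaPDF hm hl hy hr, hsmul, inv_smul_smul₀ hr.ne',
    mul_div_cancel_left₀ _ hr.ne', sq, mul_div_mul_left _ _ hr.ne']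
  ring

theorem lintegral_rescaleTotal_iidExp {m : ℕ} (hm : 0 < m) {l : ℝ} (hl : 0 < l)
    {f : (Fin m → ℝ) → ℝ≥0∞} (hf : Measurable f) :
    ∫⁻ x, ∫⁻ s, f (rescaleTotal l x s) ∂gammaMeasure m 1 ∂iidExp m l =
      ∫⁻ x, f x ∂iidExp m l := by
  have := isProbabilityMeasure_iidExp m hl
  have hpdf := measurable_iidExpPDF m l
  have hgamma : Measurable (gammaPDF m 1) := (measurable_gammaPDFReal _ _).ennreal_ofReal
  have hgamma' := measurable_gammaPDF_uncurry m
  calc ∫⁻ x, ∫⁻ s, f (rescaleTotal l x s) ∂gammaMeasure m 1 ∂iidExp m l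
      = ∫⁻ x, (∫⁻ r in Set.Ioi 0, ENNReal.ofReal (l * (∑ j, x j) / r ^ 2) *
          (gammaPDF m 1 (l * (∑ j, x j) / r) * f (r⁻¹ • x))) ∂iidExp m l :=
        lintegral_congr_ae <| by
          filter_upwards [(iidExp_absolutelyContinuous m hl).ae_le (ae_sum_pos hm)] with x hx
          exact lintegral_rescaleTotal hl hx hf
    _ = ∫⁻ r in Set.Ioi 0, ∫⁻ x, iidExpPDF m l x * (ENNReal.ofReal (l * (∑ j, x j) / r ^ 2) *
          (gammaPDF m 1 (l * (∑ j, x j) / r) * f (r⁻¹ • x))) := by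
        rw [lintegral_lintegral_swap (by fun_prop)]
        exact lintegral_congr fun r => lintegral_iidExp m hl (by fun_prop)
    _ = ∫⁻ r in Set.Ioi 0, ∫⁻ y, f y * (iidExpPDF m l y * gammaPDF m (l * ∑ j, y j) r) :=
        setLIntegral_congr_fun measurableSet_Ioi fun r hr =>
          lintegral_iidExpPDF_mul_inv_smul hm hl hf hr
    _ = ∫⁻ y, ∫⁻ r in Set.Ioi 0, f y * (iidExpPDF m l y * gammaPDF m (l * ∑ j, y j) r) :=
        lintegral_lintegral_swap (by fun_prop)
    _ = ∫⁻ y, iidExpPDF m l y * f y := by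
        refine lintegral_congr_ae ?_
        filter_upwards [(ae_restrict_iff' (measurableSet_valuationSpace m)).1 (ae_sum_pos hm)]
          with y hy
        have hrate : Measurable (gammaPDF m (l * ∑ j, y j)) :=
          (measurable_gammaPDFReal _ _).ennreal_ofReal
        rw [lintegral_const_mul _ (by fun_prop), lintegral_const_mul _ hrate, mul_comm]
        by_cases hmem : y ∈ valuationSpace m
        · rw [setLIntegral_Ioi_gammaPDF (by positivity) (mul_pos hl (hy hmem)), mul_one]
        · simp only [iidExpPDF_of_notMem l hmem, zero_mul]
    _ = ∫⁻ x, f x ∂iidExp m l := (lintegral_iidExp m hl hf).symm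

theorem measurePreserving_rescaleTotal {m : ℕ} (hm : 0 < m) {l : ℝ} (hl : 0 < l) :
    MeasurePreserving (fun p : (Fin m → ℝ) × ℝ => rescaleTotal l p.1 p.2)
      ((iidExp m l).prod (gammaMeasure m 1)) (iidExp m l) := by
  have := isProbabilityMeasure_iidExp m hl
  have := isProbabilityMeasure_gammaMeasure (a := m) (by positivity) one_pos
  have hmeas := measurable_rescaleTotal m l
  refine ⟨hmeas, Measure.ext_of_lintegral _ fun f hf => ?_⟩
  rw [lintegral_map hf hmeas, lintegral_prod (fun p => f (rescaleTotal l p.1 p.2))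
    (hf.comp hmeas).aemeasurable]
  exact lintegral_rescaleTotal_iidExp hm hl hf

/-! ### Selling one good -/

theorem ae_differentiableAt_of_locallyLipschitzOn {E : Type*} [NormedAddCommGroup E]
    [NormedSpace ℝ E] [FiniteDimensional ℝ E] [MeasurableSpace E] [BorelSpace E] (μ : Measure E)
    [μ.IsAddHaarMeasure] {f : E → ℝ} {U : Set E} (hU : IsOpen U) (hf : LocallyLipschitzOn U f) :
    ∀ᵐ x ∂μ.restrict U, DifferentiableAt ℝ f x := by
  have : ProperSpace E := FiniteDimensional.proper ℝ E
  rw [ae_restrict_iff' hU.measurableSet]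
  refine measure_null_of_locally_null _ fun x hx => ?_
  simp only [Set.mem_compl_iff, Set.mem_ofPred_eq, Classical.not_imp] at hx
  obtain ⟨K, t, ht, hLip⟩ := hf hx.1
  rw [hU.nhdsWithin_eq hx.1] at ht
  obtain ⟨V, hVt, hV, hxV⟩ := mem_nhds_iff.1 ht
  have hae := (hLip.mono hVt).ae_differentiableWithinAt_of_mem (μ := μ)
  refine ⟨V ∩ {y | ¬DifferentiableAt ℝ f y}, Filter.inter_mem
    (mem_nhdsWithin_of_mem_nhds (hV.mem_nhds hxV)) ?_, measure_mono_null (fun y hy => ?_) hae⟩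
  · filter_upwards [self_mem_nhdsWithin] with y hy using (Classical.not_imp.1 hy).2
  · exact fun h => hy.2 ((h hy.1).differentiableAt (hV.mem_nhds hy.1))

theorem ae_differentiableAt_of_convexOn {E : Type*} [NormedAddCommGroup E]
    [NormedSpace ℝ E] [FiniteDimensional ℝ E] [MeasurableSpace E] [BorelSpace E] (μ : Measure E)
    [μ.IsAddHaarMeasure] {f : E → ℝ} {s : Set E} (hf : ConvexOn ℝ s f) :
    ∀ᵐ x ∂μ.restrict s, DifferentiableAt ℝ f x := by
  have hae : interior s =ᵐ[μ] s :=
    interior_ae_eq_of_null_frontier (hf.1.addHaar_frontier μ)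
  rw [← Measure.restrict_congr_set hae]
  exact ae_differentiableAt_of_locallyLipschitzOn μ isOpen_interior hf.locallyLipschitzOn_interior

theorem absolutelyContinuousOnInterval_of_convexOn {s : Set ℝ} {f : ℝ → ℝ} (hf : ConvexOn ℝ s f)
    {a b : ℝ} (hs : Set.uIcc a b ⊆ interior s) : AbsolutelyContinuousOnInterval f a b := by
  obtain ⟨K, hK⟩ := (hf.locallyLipschitzOn_interior.mono hs).exists_lipschitzOnWith_of_compact
    isCompact_uIcc
  exact hK.absolutelyContinuousOnInterval

theorem integral_le_sub_of_absolutelyContinuousOnInterval {f F : ℝ → ℝ} {a b : ℝ} (hab : a ≤ b)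
    (hF : AbsolutelyContinuousOnInterval F a b) (hf : IntervalIntegrable f volume a b)
    (hle : ∀ᵐ x ∂volume.restrict (Set.Icc a b), f x ≤ deriv F x) :
    ∫ x in a..b, f x ≤ F b - F a := by
  rw [← hF.integral_deriv_eq_sub]
  exact intervalIntegral.integral_mono_ae_restrict hab hf hF.intervalIntegrable_deriv hle

/-- The revenue density of a single-good utility function, for a good whose value has the Gamma
distribution with shape `m`, up to the factor `1 / Γ(m)`. -/
noncomputable def oneGoodRevenueDensity (m : ℕ) (v : ℝ → ℝ) (s : ℝ) : ℝ :=
  s ^ (m - 1) * Real.exp (-s) * (s * deriv v s - v s)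

theorem hasDerivAt_sub_mul_upperGamma {m : ℕ} (hm : 0 < m) {v : ℝ → ℝ} {s : ℝ}
    (hd : DifferentiableAt ℝ v s) (k : ℝ) :
    HasDerivAt (fun s => (v s - k * s) * upperGamma m s)
      (oneGoodRevenueDensity m v s + (k - deriv v s) * gFun m s) s := by
  refine ((hd.hasDerivAt.sub ((hasDerivAt_id s).const_mul k)).mul
    (hasDerivAt_upperGamma m s)).congr_deriv ?_
  rw [oneGoodRevenueDensity, gFun_eq, ← mul_pow_sub_one hm.ne' s]
  simp only [Pi.sub_apply, id]
  ring

/-- Convex nonnegative functions on `[0, ∞)` whose derivative lies in `[0, c]` almost everywhere: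
the feasible utility functions of the buyer of a single good sold in amounts up to `c`. -/
structure IsOneGoodUtility (c : ℝ) (v : ℝ → ℝ) : Prop where
  convexOn : ConvexOn ℝ (Set.Ici 0) v
  nonneg : ∀ s, 0 ≤ s → 0 ≤ v s
  deriv_mem_Icc : ∀ᵐ s ∂volume.restrict (Set.Ioi 0), deriv v s ∈ Set.Icc 0 c

namespace IsOneGoodUtility

variable {m : ℕ} {c γ : ℝ} {v : ℝ → ℝ}

theorem ae_differentiableAt (hv : IsOneGoodUtility c v) :
    ∀ᵐ s ∂volume.restrict (Set.Ioi 0), DifferentiableAt ℝ v s := by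
  rw [restrict_Ioi_eq_restrict_Ici]
  exact ae_differentiableAt_of_convexOn volume hv.convexOn

theorem le_add_mul (hv : IsOneGoodUtility c v) {s : ℝ} (hs : 0 < s) : v s ≤ v 0 + c * s := by
  have hae : ∀ᵐ t ∂volume.restrict (Set.Ioi s),
      s < t ∧ DifferentiableAt ℝ v t ∧ deriv v t ≤ c := by
    have hsub : Set.Ioi s ⊆ Set.Ioi 0 := Set.Ioi_subset_Ioi hs.le
    filter_upwards [ae_restrict_mem measurableSet_Ioi,
      ae_restrict_of_ae_restrict_of_subset hsub hv.ae_differentiableAt,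
      ae_restrict_of_ae_restrict_of_subset hsub hv.deriv_mem_Icc] with t hst hd hc
      using ⟨hst, hd, hc.2⟩
  have : (ae (volume.restrict (Set.Ioi s))).NeBot := by
    rw [ae_neBot, Ne, Measure.restrict_eq_zero, Real.volume_Ioi]
    exact ENNReal.top_ne_zero
  obtain ⟨t, hst, hd, hc⟩ := hae.exists
  have hslope := hv.convexOn.slope_mono_adjacent Set.self_mem_Ici (hs.trans hst).le hs hst
  have hderiv := hv.convexOn.slope_le_of_hasDerivAt hs.le (hs.trans hst).le hst hd.hasDerivAt
  rw [slope_def_field] at hderiv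
  have hbound := (div_le_iff₀ (by linarith)).1 (hslope.trans (hderiv.trans hc))
  linarith

theorem absolutelyContinuousOnInterval (hv : IsOneGoodUtility c v) {a b : ℝ} (ha : 0 < a)
    (hab : a ≤ b) : AbsolutelyContinuousOnInterval v a b := by
  refine absolutelyContinuousOnInterval_of_convexOn hv.convexOn ?_
  rw [Set.uIcc_of_le hab, interior_Ici]
  exact Set.Icc_subset_Ioi_iff hab |>.2 ha

theorem integral_le_sub (hm : 0 < m) (hv : IsOneGoodUtility c v) {a b k : ℝ} (ha : 0 < a)
    (hab : a ≤ b) (hint : IntegrableOn (oneGoodRevenueDensity m v) (Set.Ioi 0))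
    (hsign : ∀ s ∈ Set.Icc a b, ∀ d ∈ Set.Icc 0 c, 0 ≤ (k - d) * gFun m s) :
    ∫ s in a..b, oneGoodRevenueDensity m v s ≤
      (v b - k * b) * upperGamma m b - (v a - k * a) * upperGamma m a := by
  have hsub : Set.Icc a b ⊆ Set.Ioi 0 := (Set.Icc_subset_Ioi_iff hab).2 ha
  have hac : AbsolutelyContinuousOnInterval (fun s => (v s - k * s) * upperGamma m s) a b :=
    ((hv.absolutelyContinuousOnInterval ha hab).sub
      (contDiff_id.contDiffOn.absolutelyContinuousOnInterval.const_mul k)).mul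
      (contDiff_upperGamma m).contDiffOn.absolutelyContinuousOnInterval
  refine integral_le_sub_of_absolutelyContinuousOnInterval hab hac
    ((intervalIntegrable_iff_integrableOn_Icc_of_le hab).2 (hint.mono_set hsub)) ?_
  filter_upwards [ae_restrict_mem measurableSet_Icc,
    ae_restrict_of_ae_restrict_of_subset hsub hv.ae_differentiableAt,
    ae_restrict_of_ae_restrict_of_subset hsub hv.deriv_mem_Icc] with s hs hd hmem
  rw [(hasDerivAt_sub_mul_upperGamma hm hd k).deriv]
  exact le_add_of_nonneg_right (hsign s hs _ hmem)

theorem integral_zero_root_le (hm : 0 < m) (hγ : 0 < γ) (hroot : gFun m γ = 0)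
    (hv : IsOneGoodUtility c v) (hint : IntegrableOn (oneGoodRevenueDensity m v) (Set.Ioi 0)) :
    ∫ s in 0..γ, oneGoodRevenueDensity m v s ≤ v γ * upperGamma m γ := by
  have hint' : IntegrableOn (oneGoodRevenueDensity m v) (Set.uIcc 0 γ) := by
    rw [Set.uIcc_of_le hγ.le, integrableOn_Icc_iff_integrableOn_Ioc]
    exact hint.mono_set Set.Ioc_subset_Ioi_self
  have hlim : Filter.Tendsto (fun a => ∫ s in a..γ, oneGoodRevenueDensity m v s)
      (nhdsWithin 0 (Set.Ioc 0 γ)) (nhds (∫ s in 0..γ, oneGoodRevenueDensity m v s)) :=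
    (intervalIntegral.continuousOn_primitive_interval_left hint' 0 Set.left_mem_uIcc).mono_left
      (nhdsWithin_mono _ (Set.Ioc_subset_Icc_self.trans Set.Icc_subset_uIcc))
  have := left_nhdsWithin_Ioc_neBot hγ
  refine le_of_tendsto hlim ?_
  filter_upwards [self_mem_nhdsWithin] with a ha
  have hnonneg : 0 ≤ v a * upperGamma m a :=
    mul_nonneg (hv.nonneg a ha.1.le) (upperGamma_pos m ha.1.le).le
  have h := integral_le_sub hm hv (k := 0) ha.1 ha.2 hint fun s hs d hd => ?_
  · linarith
  · exact mul_nonneg_of_nonpos_of_nonpos (sub_nonpos.2 hd.1)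
      (gFun_nonpos_of_le_root hm hroot (ha.1.le.trans hs.1) hs.2)

theorem integral_Ioi_root_le (hm : 0 < m) (hγ : 0 < γ) (hroot : gFun m γ = 0)
    (hv : IsOneGoodUtility c v) (hint : IntegrableOn (oneGoodRevenueDensity m v) (Set.Ioi 0)) :
    ∫ s in Set.Ioi γ, oneGoodRevenueDensity m v s ≤ (c * γ - v γ) * upperGamma m γ := by
  have hlim := intervalIntegral_tendsto_integral_Ioi γ
    (hint.mono_set (Set.Ioi_subset_Ioi hγ.le)) Filter.tendsto_id
  have hlim' := ((tendsto_upperGamma_atTop m).const_mul (v 0)).const_add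
    ((c * γ - v γ) * upperGamma m γ)
  rw [mul_zero, add_zero] at hlim'
  refine le_of_tendsto_of_tendsto hlim hlim' ?_
  filter_upwards [Filter.eventually_ge_atTop γ] with b hb
  have hmul := mul_le_mul_of_nonneg_right (hv.le_add_mul (hγ.trans_le hb))
    (upperGamma_pos m (hγ.le.trans hb)).le
  have h := integral_le_sub hm hv (k := c) hγ hb hint fun s hs d hd => ?_
  · simp only [id]; linarith
  · exact mul_nonneg (sub_nonneg.2 hd.2) (gFun_nonneg_of_root_le hm hγ.le hroot hs.1)

theorem integral_le (hm : 0 < m) (hγ : 0 < γ) (hroot : gFun m γ = 0)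
    (hv : IsOneGoodUtility c v) (hint : IntegrableOn (oneGoodRevenueDensity m v) (Set.Ioi 0)) :
    ∫ s in Set.Ioi 0, oneGoodRevenueDensity m v s ≤ c * (γ * upperGamma m γ) := by
  have hsplit := intervalIntegral.integral_interval_add_Ioi hint
    (hint.mono_set (Set.Ioi_subset_Ioi hγ.le))
  have hleft := integral_zero_root_le hm hγ hroot hv hint
  have hright := integral_Ioi_root_le hm hγ hroot hv hint
  linarith

end IsOneGoodUtility

theorem IsOneGoodUtility.integral_gammaMeasure_le {m : ℕ} (hm : 0 < m) {c γ : ℝ} {v : ℝ → ℝ}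
    (hγ : 0 < γ) (hroot : gFun m γ = 0) (hv : IsOneGoodUtility c v)
    (hint : Integrable (fun s => s * deriv v s - v s) (gammaMeasure m 1)) :
    ∫ s, (s * deriv v s - v s) ∂gammaMeasure m 1 ≤ c * (γ * upperGamma m γ) / Real.Gamma m := by
  rw [integral_gammaMeasure hm]
  exact div_le_div_of_nonneg_right
    (hv.integral_le hm hγ hroot ((integrable_gammaMeasure_iff hm _).1 hint))
    (Real.Gamma_pos_of_pos (by positivity)).le

/-! ### Revenue along rays -/

theorem fderiv_apply_eq_sum_partialD {m : ℕ} (u : (Fin m → ℝ) → ℝ) (x y : Fin m → ℝ) :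
    fderiv ℝ u x y = ∑ j, partialD u j x * y j := by
  conv_lhs => rw [pi_eq_sum_univ' y, map_sum]
  refine Finset.sum_congr rfl fun j _ => ?_
  rw [map_smul, smul_eq_mul, mul_comm, partialD]

/-- The derivative of `u` at `x` in the direction `x`, written `∇u(x) · x` in the revenue
functional. -/
noncomputable def radialD {m : ℕ} (u : (Fin m → ℝ) → ℝ) (x : Fin m → ℝ) : ℝ :=
  ∑ j, partialD u j x * x j

theorem measurable_radialD {m : ℕ} (u : (Fin m → ℝ) → ℝ) : Measurable (radialD u) := by
  unfold radialD partialD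
  exact Finset.measurable_sum _ fun j _ =>
    (measurable_fderiv_apply_const ℝ u _).mul (measurable_pi_apply j)

theorem radialD_mem_Icc {m : ℕ} {u : (Fin m → ℝ) → ℝ} {x : Fin m → ℝ} (hx : x ∈ valuationSpace m)
    (h : ∀ j, partialD u j x ∈ Set.Icc (0 : ℝ) 1) : radialD u x ∈ Set.Icc 0 (∑ j, x j) :=
  ⟨Finset.sum_nonneg fun j _ => mul_nonneg (h j).1 (hx j),
    Finset.sum_le_sum fun j _ => mul_le_of_le_one_left (hx j) (h j).2⟩

section Ray

variable {m : ℕ} {l : ℝ} {u : (Fin m → ℝ) → ℝ} {x : Fin m → ℝ}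

theorem rescaleTotal_mem_valuationSpace (hl : 0 ≤ l) (hx : x ∈ valuationSpace m) {s : ℝ}
    (hs : 0 ≤ s) : rescaleTotal l x s ∈ valuationSpace m :=
  smul_mem_valuationSpace hx
    (div_nonneg hs (mul_nonneg hl (sum_nonneg_of_mem_valuationSpace hx)))

theorem convexOn_comp_rescaleTotal (hl : 0 ≤ l) (hu : ConvexOn ℝ (valuationSpace m) u)
    (hx : x ∈ valuationSpace m) : ConvexOn ℝ (Set.Ici 0) fun s => u (rescaleTotal l x s) := by
  let ray := LinearMap.toSpanSingleton ℝ (Fin m → ℝ) ((l * ∑ j, x j)⁻¹ • x)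
  have hray (s : ℝ) : ray s = rescaleTotal l x s := by
    rw [LinearMap.toSpanSingleton_apply, smul_smul, ← div_eq_mul_inv, rescaleTotal]
  have hmaps : Set.Ici 0 ⊆ ray ⁻¹' valuationSpace m := fun s hs => by
    rw [Set.mem_preimage, hray]
    exact rescaleTotal_mem_valuationSpace hl hx hs
  simpa only [Function.comp_def, hray] using (hu.comp_linearMap ray).subset hmaps (convex_Ici 0)

theorem mul_deriv_comp_rescaleTotal {s : ℝ} (hd : DifferentiableAt ℝ u (rescaleTotal l x s)) :
    s * deriv (fun s => u (rescaleTotal l x s)) s = radialD u (rescaleTotal l x s) := by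
  have hray : HasDerivAt (rescaleTotal l x) ((1 / (l * ∑ j, x j)) • x) s :=
    ((hasDerivAt_id s).div_const _).smul_const x
  have hderiv := (hd.hasFDerivAt.comp_hasDerivAt s hray).deriv
  simp only [Function.comp_def] at hderiv
  rw [hderiv, radialD, ← fderiv_apply_eq_sum_partialD, ← smul_eq_mul, ← map_smul, smul_smul,
    mul_one_div, rescaleTotal]

end Ray

section Resampling

variable {m : ℕ} {l : ℝ} {f : (Fin m → ℝ) → ℝ}

theorem ae_ae_rescaleTotal (hm : 0 < m) (hl : 0 < l) {P : (Fin m → ℝ) → Prop}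
    (hP : ∀ᵐ x ∂volume.restrict (valuationSpace m), P x) :
    ∀ᵐ x ∂iidExp m l, ∀ᵐ s ∂gammaMeasure m 1, P (rescaleTotal l x s) := by
  have := isProbabilityMeasure_gammaMeasure (a := m) (by positivity) one_pos
  exact Measure.ae_ae_of_ae_prod ((measurePreserving_rescaleTotal hm hl).quasiMeasurePreserving.ae
    ((iidExp_absolutelyContinuous m hl).ae_le hP))

theorem integrable_comp_rescaleTotal (hm : 0 < m) (hl : 0 < l) (hf : Integrable f (iidExp m l)) :
    Integrable (fun p : (Fin m → ℝ) × ℝ => f (rescaleTotal l p.1 p.2))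
      ((iidExp m l).prod (gammaMeasure m 1)) :=
  (measurePreserving_rescaleTotal hm hl).integrable_comp_of_integrable hf

theorem integral_eq_integral_integral_rescaleTotal (hm : 0 < m) (hl : 0 < l)
    (hf : Integrable f (iidExp m l)) :
    ∫ x, f x ∂iidExp m l = ∫ x, ∫ s, f (rescaleTotal l x s) ∂gammaMeasure m 1 ∂iidExp m l := by
  have := isProbabilityMeasure_iidExp m hl
  have := isProbabilityMeasure_gammaMeasure (a := m) (by positivity) one_pos
  have hmp := measurePreserving_rescaleTotal hm hl
  rw [← integral_prod _ (integrable_comp_rescaleTotal hm hl hf)]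
  nth_rewrite 1 [← hmp.map_eq]
  exact integral_map hmp.aemeasurable (hmp.map_eq.symm ▸ hf.aestronglyMeasurable)

end Resampling

namespace IsFeasibleUtility

variable {m : ℕ} {l : ℝ} {u : (Fin m → ℝ) → ℝ}

theorem ae_isOneGoodUtility (hm : 0 < m) (hl : 0 < l) (hu : IsFeasibleUtility u) :
    ∀ᵐ x ∂iidExp m l, IsOneGoodUtility l⁻¹ fun s => u (rescaleTotal l x s) := by
  filter_upwards [ae_iidExp_mem_valuationSpace m hl,
    (iidExp_absolutelyContinuous m hl).ae_le (ae_sum_pos hm),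
    ae_ae_rescaleTotal hm hl hu.2.2,
    ae_ae_rescaleTotal hm hl (ae_differentiableAt_of_convexOn volume hu.1)] with x hx hsum hpart hd
  have hmem {s : ℝ} (hs : 0 ≤ s) := rescaleTotal_mem_valuationSpace hl.le hx hs
  refine ⟨convexOn_comp_rescaleTotal hl.le hu.1 hx, fun s hs => hu.2.1 _ (hmem hs), ?_⟩
  have hac := restrict_Ioi_absolutelyContinuous_gammaMeasure (Nat.cast_pos.2 hm) one_pos
  filter_upwards [ae_restrict_mem measurableSet_Ioi, hac.ae_le hpart, hac.ae_le hd]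
    with s hs hpart hd
  have hrad := radialD_mem_Icc (hmem (le_of_lt hs)) hpart
  rw [← mul_deriv_comp_rescaleTotal hd, sum_rescaleTotal hl hsum, div_eq_mul_inv] at hrad
  exact ⟨nonneg_of_mul_nonneg_right hrad.1 hs, le_of_mul_le_mul_left hrad.2 hs⟩

theorem ae_le_add_sum (hm : 0 < m) (hl : 0 < l) (hu : IsFeasibleUtility u) :
    ∀ᵐ x ∂iidExp m l, u x ≤ u 0 + ∑ j, x j := by
  filter_upwards [hu.ae_isOneGoodUtility hm hl,
    (iidExp_absolutelyContinuous m hl).ae_le (ae_sum_pos hm)] with x hray hsum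
  have htotal : 0 < l * ∑ j, x j := mul_pos hl hsum
  have h := hray.le_add_mul htotal
  simpa only [rescaleTotal, div_self htotal.ne', zero_div, one_smul, zero_smul,
    inv_mul_cancel_left₀ hl.ne'] using h

theorem integrable (hm : 0 < m) (hl : 0 < l) (hu : IsFeasibleUtility u) :
    Integrable u (iidExp m l) := by
  have := isProbabilityMeasure_iidExp m hl
  have hmeas : AEStronglyMeasurable u (volume.restrict (valuationSpace m)) := by
    rw [← restrict_interior_valuationSpace]
    exact hu.1.continuousOn_interior.aestronglyMeasurable isOpen_interior.measurableSet
  refine ((integrable_const (u 0)).add (integrable_sum_iidExp m hl)).mono'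
    (hmeas.mono_ac (iidExp_absolutelyContinuous m hl)) ?_
  filter_upwards [hu.ae_le_add_sum hm hl, ae_iidExp_mem_valuationSpace m hl] with x hx hmem
  rwa [Real.norm_of_nonneg (hu.2.1 x hmem)]

theorem integrable_radialD (hl : 0 < l) (hu : IsFeasibleUtility u) :
    Integrable (radialD u) (iidExp m l) := by
  refine (integrable_sum_iidExp m hl).mono' (measurable_radialD u).aestronglyMeasurable ?_
  filter_upwards [(iidExp_absolutelyContinuous m hl).ae_le hu.2.2,
    ae_iidExp_mem_valuationSpace m hl] with x hpart hx
  have hrad := radialD_mem_Icc hx hpart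
  rw [Real.norm_of_nonneg hrad.1]
  exact hrad.2

theorem utilityRevenue_le (hm : 0 < m) (hl : 0 < l) {γ : ℝ} (hγ : 0 < γ) (hroot : gFun m γ = 0)
    (hu : IsFeasibleUtility u) :
    utilityRevenue u (iidExp m l) ≤ l⁻¹ * (γ * upperGamma m γ) / Real.Gamma m := by
  have := isProbabilityMeasure_iidExp m hl
  have := isProbabilityMeasure_gammaMeasure (a := m) (by positivity) one_pos
  have hint : Integrable (fun x => radialD u x - u x) (iidExp m l) :=
    (hu.integrable_radialD hl).sub (hu.integrable hm hl)
  have hresample := integrable_comp_rescaleTotal hm hl hint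
  have hae : ∀ᵐ x ∂iidExp m l, ∫ s, (radialD u (rescaleTotal l x s) -
      u (rescaleTotal l x s)) ∂gammaMeasure m 1 ≤ l⁻¹ * (γ * upperGamma m γ) / Real.Gamma m := by
    filter_upwards [hu.ae_isOneGoodUtility hm hl, hresample.prod_right_ae,
      ae_ae_rescaleTotal hm hl (ae_differentiableAt_of_convexOn volume hu.1)] with x hray hint hd
    have hcongr : (fun s => radialD u (rescaleTotal l x s) - u (rescaleTotal l x s))
        =ᵐ[gammaMeasure m 1] fun s =>
          s * deriv (fun s => u (rescaleTotal l x s)) s - u (rescaleTotal l x s) := by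
      filter_upwards [hd] with s hd
      rw [mul_deriv_comp_rescaleTotal hd]
    rw [integral_congr_ae hcongr]
    exact hray.integral_gammaMeasure_le hm hγ hroot (hint.congr hcongr)
  calc utilityRevenue u (iidExp m l)
      = ∫ x, ∫ s, (radialD u (rescaleTotal l x s) - u (rescaleTotal l x s)) ∂gammaMeasure m 1
          ∂iidExp m l := integral_eq_integral_integral_rescaleTotal hm hl hint
    _ ≤ ∫ _, l⁻¹ * (γ * upperGamma m γ) / Real.Gamma m ∂iidExp m l :=
      integral_mono_ae hresample.integral_prod_left (integrable_const _) hae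
    _ = l⁻¹ * (γ * upperGamma m γ) / Real.Gamma m := by
      rw [integral_const, probReal_univ, one_smul]

end IsFeasibleUtility

/-! ### Mechanisms -/

namespace Mechanism

variable {m : ℕ} {l : ℝ} {M : Mechanism m}

theorem IsFeasible.partialD_utility (hM : M.IsFeasible) {x : Fin m → ℝ}
    (hx : x ∈ interior (valuationSpace m))
    (hd : DifferentiableAt ℝ (fun y => M.utility y y) x) (j : Fin m) :
    partialD (fun y => M.utility y y) j x = M.alloc x j := by
  -- Truthfulness at nearby types: the gain from not reporting `x` is minimal at `x` itself.
  have hmin : IsLocalMin (fun y => M.utility y y - M.utility x y) x := by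
    filter_upwards [isOpen_interior.mem_nhds hx] with y hy
    rw [sub_self, sub_nonneg]
    exact hM.2.2 y (interior_subset hy) x (interior_subset hx)
  have hreport : HasFDerivAt (fun y : Fin m → ℝ => M.utility x y)
      (∑ i, M.alloc x i • (ContinuousLinearMap.proj i : (Fin m → ℝ) →L[ℝ] ℝ)) x :=
    HasFDerivAt.sub_const _ (HasFDerivAt.fun_sum fun i _ =>
      (hasFDerivAt_apply i x).const_mul (M.alloc x i))
  rw [partialD, sub_eq_zero.1 (hmin.hasFDerivAt_eq_zero (hd.hasFDerivAt.sub hreport))]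
  simp [Pi.single_apply]

theorem utility_add_smul (M : Mechanism m) (x' x y : Fin m → ℝ) {a b : ℝ} (hab : a + b = 1) :
    M.utility x' (a • x + b • y) = a * M.utility x' x + b * M.utility x' y := by
  have hpay : M.pay x' = a * M.pay x' + b * M.pay x' := by rw [← add_mul, hab, one_mul]
  have hvalue : ∑ j, M.alloc x' j * (a • x + b • y) j =
      a * ∑ j, M.alloc x' j * x j + b * ∑ j, M.alloc x' j * y j := by
    rw [Finset.mul_sum, Finset.mul_sum, ← Finset.sum_add_distrib]
    refine Finset.sum_congr rfl fun j _ => ?_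
    rw [Pi.add_apply, Pi.smul_apply, Pi.smul_apply, smul_eq_mul, smul_eq_mul]
    ring
  unfold utility
  linarith

theorem IsIC.convexOn_utility (hM : M.IsIC) :
    ConvexOn ℝ (valuationSpace m) fun x => M.utility x x := by
  refine ⟨convex_valuationSpace m, fun x hx y hy a b ha hb hab => ?_⟩
  have hz : a • x + b • y ∈ valuationSpace m := convex_valuationSpace m hx hy ha hb hab
  calc M.utility (a • x + b • y) (a • x + b • y)
      = a * M.utility (a • x + b • y) x + b * M.utility (a • x + b • y) y :=
        M.utility_add_smul _ x y hab
    _ ≤ a * M.utility x x + b * M.utility y y := by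
        gcongr
        exacts [hM x hx _ hz, hM y hy _ hz]

theorem IsFeasible.isFeasibleUtility (hM : M.IsFeasible) :
    IsFeasibleUtility fun x => M.utility x x := by
  have hconv := hM.2.2.convexOn_utility
  refine ⟨hconv, hM.2.1, ?_⟩
  filter_upwards [ae_mem_interior_valuationSpace m, ae_differentiableAt_of_convexOn volume hconv]
    with x hx hd j
  rw [hM.partialD_utility hx hd]
  exact (hM.1 x (interior_subset hx)).1 j

theorem IsFeasible.pay_ae_eq (hM : M.IsFeasible) :
    M.pay =ᵐ[volume.restrict (valuationSpace m)]
      fun x => radialD (fun y => M.utility y y) x - M.utility x x := by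
  filter_upwards [ae_mem_interior_valuationSpace m,
    ae_differentiableAt_of_convexOn volume hM.2.2.convexOn_utility] with x hx hd
  simp only [radialD, hM.partialD_utility hx hd]
  exact (sub_sub_cancel _ _).symm

theorem IsFeasible.integrable_pay (hm : 0 < m) (hl : 0 < l) (hM : M.IsFeasible) :
    Integrable M.pay (iidExp m l) :=
  have hu := hM.isFeasibleUtility
  ((hu.integrable_radialD hl).sub (hu.integrable hm hl)).congr
    ((iidExp_absolutelyContinuous m hl).ae_eq hM.pay_ae_eq).symm

theorem IsFeasible.revenue_eq_utilityRevenue (hl : 0 < l) (hM : M.IsFeasible) :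
    M.revenue (iidExp m l) = utilityRevenue (fun x => M.utility x x) (iidExp m l) :=
  integral_congr_ae ((iidExp_absolutelyContinuous m hl).ae_eq hM.pay_ae_eq)

section FullBundle

variable {q : ℝ}

theorem fullBundle_utility (m : ℕ) (q : ℝ) (x' x : Fin m → ℝ) :
    (fullBundle m q).utility x' x = if q ≤ ∑ j, x' j then ∑ j, x j - q else 0 := by
  by_cases h : q ≤ ∑ j, x' j <;> simp [utility, fullBundle, h]

theorem isFeasible_fullBundle (m : ℕ) (hq : 0 ≤ q) : (fullBundle m q).IsFeasible := by
  refine ⟨fun x _ => ⟨fun j => ?_, ?_⟩, fun x _ => ?_, fun x _ x' _ => ?_⟩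
  · by_cases h : q ≤ ∑ j, x j <;> simp [fullBundle, h]
  · by_cases h : q ≤ ∑ j, x j <;> simp [fullBundle, h, hq]
  · rw [fullBundle_utility]
    split_ifs with h
    exacts [sub_nonneg.2 h, le_rfl]
  · rw [fullBundle_utility, fullBundle_utility]
    split_ifs <;> linarith

theorem fullBundle_pay_rescaleTotal (hl : 0 < l) (q : ℝ) {x : Fin m → ℝ} (hx : 0 < ∑ j, x j)
    (s : ℝ) : (fullBundle m q).pay (rescaleTotal l x s) =
      (Set.Ici (l * q)).indicator (fun _ => q) s := by
  simp only [fullBundle, sum_rescaleTotal hl hx, le_div_iff₀' hl, Set.indicator_apply, Set.mem_Ici]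

theorem fullBundle_revenue (hm : 0 < m) (hl : 0 < l) (hq : 0 ≤ q) :
    (fullBundle m q).revenue (iidExp m l) = q * upperGamma m (l * q) / Real.Gamma m := by
  have := isProbabilityMeasure_iidExp m hl
  have hae : ∀ᵐ x ∂iidExp m l,
      ∫ s, (fullBundle m q).pay (rescaleTotal l x s) ∂gammaMeasure m 1 =
        q * upperGamma m (l * q) / Real.Gamma m := by
    filter_upwards [(iidExp_absolutelyContinuous m hl).ae_le (ae_sum_pos hm)] with x hx
    simp only [fullBundle_pay_rescaleTotal hl q hx]
    rw [integral_indicator_const _ measurableSet_Ici, gammaMeasure_real_Ici hm (by positivity),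
      smul_eq_mul, div_mul_eq_mul_div, mul_comm q]
  rw [revenue, integral_eq_integral_integral_rescaleTotal hm hl
      ((isFeasible_fullBundle m hq).integrable_pay hm hl),
    integral_congr_ae hae, integral_const, probReal_univ, one_smul]

theorem fullBundle_revenue_div (hm : 0 < m) (hl : 0 < l) {w : ℝ} (hw : 0 ≤ w) :
    (fullBundle m (w / l)).revenue (iidExp m l) =
      l⁻¹ * (w * upperGamma m w) / Real.Gamma m := by
  rw [fullBundle_revenue hm hl (by positivity), mul_div_cancel₀ w hl.ne', div_mul_eq_mul_div,
    inv_mul_eq_div]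

theorem fullBundle_revenue_lt (hm : 0 < m) (hl : 0 < l) {γ : ℝ} (hγ : 0 < γ)
    (hroot : gFun m γ = 0) (hq : 0 ≤ q) (hne : q ≠ γ / l) :
    (fullBundle m q).revenue (iidExp m l) < (fullBundle m (γ / l)).revenue (iidExp m l) := by
  have hlq : l * q ≠ γ := fun h => hne ((eq_div_iff hl.ne').2 (mul_comm l q ▸ h))
  have : 0 < Real.Gamma m := Real.Gamma_pos_of_pos (by positivity)
  rw [← mul_div_cancel_left₀ q hl.ne', fullBundle_revenue_div hm hl (by positivity),
    fullBundle_revenue_div hm hl hγ.le]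
  gcongr l⁻¹ * ?_ / _
  exact mul_upperGamma_lt hm hγ.le hroot (by positivity) hlq

end FullBundle

end Mechanism

theorem IsFeasibleUtility.utilityRevenue_le_fullBundle_revenue {m : ℕ} {l : ℝ} (hm : 0 < m)
    (hl : 0 < l) {γ : ℝ} (hγ : 0 < γ) (hroot : gFun m γ = 0) {u : (Fin m → ℝ) → ℝ}
    (hu : IsFeasibleUtility u) :
    utilityRevenue u (iidExp m l) ≤ (Mechanism.fullBundle m (γ / l)).revenue (iidExp m l) := by
  rw [Mechanism.fullBundle_revenue_div hm hl hγ.le]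
  exact hu.utilityRevenue_le hm hl hγ hroot

theorem mainTheorem1 (m : ℕ) (hm : 0 < m) (l : ℝ) (hl : 0 < l) :
    ∃ γ : ℝ,
      -- `γ` is the unique root of `g(m, ·)` on `[0, ∞)`, and it is positive
      (0 < γ ∧ gFun m γ = 0 ∧ ∀ w : ℝ, 0 ≤ w → gFun m w = 0 → w = γ) ∧
      -- expected revenues are well defined
      (∀ M : Mechanism m, M.IsFeasible → Integrable M.pay (iidExp m l)) ∧
      -- full bundling at the price `γ / l` is an optimal mechanism
      (Mechanism.fullBundle m (γ / l)).IsOptimal (iidExp m l) ∧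
      -- no other bundle price is optimal
      (∀ q : ℝ, 0 ≤ q → (Mechanism.fullBundle m q).IsOptimal (iidExp m l) → q = γ / l) ∧
      -- its revenue is the maximum of `R(u; F)` over all feasible utility functions `u`
      IsGreatest {r : ℝ | ∃ u : (Fin m → ℝ) → ℝ,
          IsFeasibleUtility u ∧ r = utilityRevenue u (iidExp m l)}
        ((Mechanism.fullBundle m (γ / l)).revenue (iidExp m l)) := by
  obtain ⟨γ, hγ, hroot⟩ := exists_gFun_eq_zero hm
  have hfeas := Mechanism.isFeasible_fullBundle m (div_pos hγ hl).le
  have hmax {u : (Fin m → ℝ) → ℝ} (hu : IsFeasibleUtility u) :=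
    hu.utilityRevenue_le_fullBundle_revenue hm hl hγ hroot
  refine ⟨γ, ⟨hγ, hroot, fun w => eq_of_gFun_eq_zero hm hγ.le hroot⟩,
    fun M hM => hM.integrable_pay hm hl, ⟨hfeas, fun M hM => ?_⟩, fun q hq hopt => ?_,
    ⟨_, hfeas.isFeasibleUtility, hfeas.revenue_eq_utilityRevenue hl⟩, ?_⟩
  · rw [hM.revenue_eq_utilityRevenue hl]
    exact hmax hM.isFeasibleUtility
  · by_contra hne
    exact (Mechanism.fullBundle_revenue_lt hm hl hγ hroot hq hne).not_ge (hopt.2 _ hfeas)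
  · rintro _ ⟨u, hu, rfl⟩
    exact hmax hu
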